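/- Let $K$ be an algebraically closed field of characteristic zero and let $R$ be a finite-dimensional commutative associative local $K$-algebra with unit and maximal ideal $\mathfrak m$. For a hyperplane $V$ in $\mathfrak m$ (a $K$-subspace of codimension one) that generates $R$ as an algebra with unit, a symmetric $d$-linear form $F\colon R^d\to K$ is called *invariant with respect to $V$* if $F(1,\dots,1)=0$, the restriction of $F$ to $\mathfrak m$ is nonzero, and $$F(ab_1,b_2,\dots,b_d)+F(b_1,ab_2,\dots,b_d)+\dots+F(b_1,b_2,\dots,ab_d)=0\qquad\text{for all } a\in V,\ b_1,\dots,b_d\in R.$$ The form $F$ is called *invariant* if it is invariant with respect to some such $V$. An invariant form $F$ is called *irreducible* if it is not the product of two forms $F_1$, $F_2$ (of degrees $d_1+d_2=d$) that are invariant with respect to the same hyperplane; here the product is the symmetric one, $$(F_1F_2)(b_1,\dots,b_d)=\frac1{d!}\sum_{\sigma\in S_d}F_1(b_{\sigma(1)},\dots,b_{\sigma(d_1)})\,F_2(b_{\sigma(d_1+1)},\dots,b_{\sigma(d)}),$$ i.e. the polarization of the polynomial $v\mapsto F_1(v,\dots,v)F_2(v,\dots,v)$. Let $W$ be a hyperplane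 in $\mathfrak m$ that generates $R$ as an algebra with unit, and let $d$ be the maximal exponent such that $\mathfrak m^d\not\subseteq W$. Fix an isomorphism $\mathfrak m/W\cong K$ and let $\pi\colon\mathfrak m\to\mathfrak m/W\cong K$ be the projection. Then there is a unique $d$-linear form $F_W\colon R^d\to K$ such that, whenever each $b_i$ is either $1$ or an element of $\mathfrak m$, $$F_W(b_1,\dots,b_d)=(-1)^k\,k!\,(d-k-1)!\,\pi(b_1\cdots b_d),$$ where $k<d$ is the number of indices $i$ with $b_i=1$, and $F_W(1,\dots,1)=0$ (the case $k=d$). This form $F_W$ is invariant with respect to $W$, and it is an irreducible invariant $d$-linear form on $R$. -/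

import Mathlib

open IsLocalRing

namespace LocalAlgForm

variable {K R : Type*} [Field K] [CommRing R] [IsLocalRing R] [Algebra K R]

/-- `W` is a hyperplane (a subspace of codimension one) of the maximal ideal which generates `R`
as a `K`-algebra with unit. -/
structure IsGeneratingHyperplane (W : Submodule K (maximalIdeal R)) : Prop where
  codim_one : Module.finrank K (maximalIdeal R ⧸ W) = 1
  generates : Algebra.adjoin K ((fun x : maximalIdeal R => (x : R)) '' (W : Set (maximalIdeal R))) = ⊤

/-- The `d`-linear form `F` on `R` is invariant with respect to the subspace `W` of the maximal
ideal: it is symmetric, `F(1,…,1) = 0`, its restriction to the maximal ideal is nonzero, and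
`F(ab₁,b₂,…,b_d) + F(b₁,ab₂,…,b_d) + … + F(b₁,b₂,…,ab_d) = 0` for all `a ∈ W` and `bᵢ ∈ R`. -/
structure IsInvariantWrt (W : Submodule K (maximalIdeal R)) {d : ℕ}
    (F : MultilinearMap K (fun _ : Fin d => R) K) : Prop where
  symmetric : ∀ (σ : Equiv.Perm (Fin d)) (b : Fin d → R), F (fun i => b (σ i)) = F b
  map_one : F (fun _ => 1) = 0
  ne_zero : ∃ z : Fin d → R, (∀ i, z i ∈ maximalIdeal R) ∧ F z ≠ 0
  star : ∀ a ∈ W, ∀ b : Fin d → R, ∑ i, F (Function.update b i ((a : R) * b i)) = 0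

/-- An invariant `d`-linear form on `R`: one that is invariant with respect to some generating
hyperplane of the maximal ideal. -/
def IsInvariant {d : ℕ} (F : MultilinearMap K (fun _ : Fin d => R) K) : Prop :=
  ∃ W : Submodule K (maximalIdeal R), IsGeneratingHyperplane W ∧ IsInvariantWrt W F

/-- The product of two symmetric multilinear forms as a symmetric multilinear form, that is, the
polarization of the product of the polynomials `v ↦ F₁(v,…,v)` and `v ↦ F₂(v,…,v)`. -/
noncomputable def symProd {d₁ d₂ : ℕ} (F₁ : MultilinearMap K (fun _ : Fin d₁ => R) K)
    (F₂ : MultilinearMap K (fun _ : Fin d₂ => R) K) (b : Fin (d₁ + d₂) → R) : K :=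
  ((Nat.factorial (d₁ + d₂) : ℕ) : K)⁻¹ *
    ∑ σ : Equiv.Perm (Fin (d₁ + d₂)),
      F₁ (fun i => b (σ (Fin.castAdd d₂ i))) * F₂ (fun j => b (σ (Fin.natAdd d₁ j)))

/-- An irreducible invariant form: an invariant form that is not the product of two forms that are
invariant with respect to one and the same generating hyperplane. -/
def IsIrreducibleInvariant {d : ℕ} (F : MultilinearMap K (fun _ : Fin d => R) K) : Prop :=
  IsInvariant F ∧
    ¬ ∃ W : Submodule K (maximalIdeal R), IsGeneratingHyperplane W ∧
      ∃ (d₁ d₂ : ℕ) (h : d₁ + d₂ = d)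
        (F₁ : MultilinearMap K (fun _ : Fin d₁ => R) K)
        (F₂ : MultilinearMap K (fun _ : Fin d₂ => R) K),
        IsInvariantWrt W F₁ ∧ IsInvariantWrt W F₂ ∧
          ∀ b : Fin d → R, F b = symProd F₁ F₂ (fun i => b (Fin.cast h i))

/-- The projection `π : 𝔪 → 𝔪 / W ≅ K`. -/
def proj (W : Submodule K (maximalIdeal R)) (e : (maximalIdeal R ⧸ W) ≃ₗ[K] K) :
    maximalIdeal R →ₗ[K] K :=
  e.toLinearMap ∘ₗ W.mkQ

/-- The `d`-linear form `F` is given by the explicit formula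
`F(b₁,…,b_d) = (-1)ᵏ k! (d-k-1)! π(b₁⋯b_d)` on tuples whose entries are `1` or in the maximal
ideal, `k` being the number of entries equal to `1`, and by `F(1,…,1) = 0` if `k = d`.
(The product of such a tuple lies in the maximal ideal exactly if `k < d`.) -/
def HasExplicitFormula (W : Submodule K (maximalIdeal R)) (e : (maximalIdeal R ⧸ W) ≃ₗ[K] K)
    {d : ℕ} (F : MultilinearMap K (fun _ : Fin d => R) K) : Prop :=
  F (fun _ => 1) = 0 ∧
    ∀ b : Fin d → R, (∀ i, b i = 1 ∨ b i ∈ maximalIdeal R) →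
      ∀ h : ∏ i, b i ∈ maximalIdeal R,
        F b = (-1) ^ {i | b i = 1}.ncard * (Nat.factorial {i | b i = 1}.ncard : K) *
          (Nat.factorial (d - {i | b i = 1}.ncard - 1) : K) * proj W e ⟨∏ i, b i, h⟩

end LocalAlgForm

/-! Since `R = K ⊕ 𝔪`, a multilinear form is determined by its values on tuples with entries `1` or
in `𝔪` (`multilinearMap_ext_of_one_or_mem`); uniqueness, symmetry and invariance are all checked
there. For such a tuple with `k` ones, every term of the invariance sum is a multiple of `π(a
b₁⋯b_d)`, with total factor `k c_{k-1} + (d-k) c_k`, where `c_k = (-1)ᵏ k! (d-k-1)!`. This vanishes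
for `0 < k < d`. If `k = 0`, then `a b₁⋯b_d ∈ 𝔪^(d+1) ⊆ W`; if `k = d`, the value is `π(a) = 0`.
Irreducibility: a product of two forms vanishing at `(1,…,1)` vanishes there to second order,
whereas `F_W(z,1,…,1) = ±(d-1)! π(z) ≠ 0` for `z ∉ W`. -/

namespace LocalAlgForm

/-! ### Augmentation and reduction to entries `1` or in `𝔪` -/

section AlgHom

variable {K R : Type*} [Field K] [CommRing R] [IsLocalRing R] [Algebra K R]

/-- A finite-dimensional local algebra over an algebraically closed field is augmented over that
field, with kernel the maximal ideal. -/
theorem exists_algHom_ker_eq_maximalIdeal [IsAlgClosed K] [FiniteDimensional K R] :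
    ∃ ε : R →ₐ[K] K, ∀ r, ε r = 0 ↔ r ∈ maximalIdeal R := by
  have hbij : Function.Bijective (algebraMap K (ResidueField R)) :=
    IsAlgClosed.algebraMap_bijective_of_isIntegral
  let f : K ≃ₐ[K] ResidueField R := AlgEquiv.ofBijective (Algebra.ofId K (ResidueField R)) hbij
  refine ⟨(f.symm : ResidueField R →ₐ[K] K).comp (IsScalarTower.toAlgHom K R (ResidueField R)),
    fun r => ?_⟩
  rw [← residue_eq_zero_iff]
  simp

theorem not_mem_of_eq_one {x : R} (h : x = 1) : x ∉ maximalIdeal R := by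
  subst h
  exact (Ideal.ne_top_iff_one _).1 (maximalIdeal.isMaximal R).ne_top

/-- Multilinear forms on an augmented local algebra are determined by their values on tuples of
entries that are `1` or in the maximal ideal. -/
theorem multilinearMap_ext_of_one_or_mem {ι : Type*} [Finite ι] (ε : R →ₐ[K] K)
    (hε : ∀ r, ε r = 0 ↔ r ∈ maximalIdeal R) {F G : MultilinearMap K (fun _ : ι => R) K}
    (h : ∀ b : ι → R, (∀ i, b i = 1 ∨ b i ∈ maximalIdeal R) → F b = G b) : F = G := by
  classical
  have := Fintype.ofFinite ι
  -- Induction on the set `s` of positions whose entries are still arbitrary.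
  suffices H : ∀ (s : Finset ι) (b : ι → R),
      (∀ i, i ∉ s → b i = 1 ∨ b i ∈ maximalIdeal R) → F b = G b from
    MultilinearMap.ext fun b => H Finset.univ b (by simp)
  intro s
  induction s using Finset.induction with
  | empty => exact fun b hb => h b fun i => hb i (by simp)
  | insert i s _ ih =>
    intro b hb
    have key : ∀ x, x = 1 ∨ x ∈ maximalIdeal R →
        F (Function.update b i x) = G (Function.update b i x) := by
      refine fun x hx => ih _ fun j hj => ?_
      rcases eq_or_ne j i with rfl | hji
      · simpa using hx
      · simpa [hji] using hb j (by simp [hji, hj])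
    have hbi : b i = ε (b i) • (1 : R) + (b i - ε (b i) • (1 : R)) := by abel
    have hmem : b i - ε (b i) • (1 : R) ∈ maximalIdeal R := by
      rw [← hε]; simp
    rw [← Function.update_eq_self i b, hbi]
    simp only [MultilinearMap.map_update_add, MultilinearMap.map_update_smul,
      key _ (Or.inl rfl), key _ (Or.inr hmem)]

/-- `A` is only an additive subgroup, as it will be `ker π`; pulling it back along multiplication by
`a` keeps the induction going. The exponent must be positive: the empty product only puts `1` in
`A`, not all of `I ^ 0`. -/
theorem pow_succ_subset_of_prod_mem {S : Type*} [CommRing S] (I : Ideal S) (n : ℕ)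
    (A : AddSubgroup S) (h : ∀ z : Fin (n + 1) → S, (∀ i, z i ∈ I) → ∏ i, z i ∈ A) :
    ∀ x ∈ I ^ (n + 1), x ∈ A := by
  induction n generalizing A with
  | zero =>
    intro x hx
    simpa using h (fun _ => x) (by simpa using hx)
  | succ n ih =>
    intro x hx
    rw [pow_succ'] at hx
    refine Submodule.mul_induction_on hx (fun a ha y hy => ?_) fun _ _ => A.add_mem
    refine ih (A.comap (AddMonoidHom.mulLeft a)) (fun z hz => ?_) y hy
    have := h (Fin.cons a z) (Fin.cases ha hz)
    simpa [Fin.prod_univ_succ] using this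

end AlgHom

/-! ### Construction of `F_W` -/

section Construction

variable {K R : Type*} [Field K] [CommRing R] [IsLocalRing R] [Algebra K R]
variable (ε : R →ₐ[K] K) (hε : ∀ r, ε r = 0 ↔ r ∈ maximalIdeal R)

/-- The component in the maximal ideal with respect to `R = K ⊕ 𝔪`. -/
def nilPart : R →ₗ[K] maximalIdeal R where
  toFun r := ⟨r - algebraMap K R (ε r), (hε _).1 (by simp)⟩
  map_add' x y := Subtype.ext (by simp; ring)
  map_smul' c x := Subtype.ext (by simp [Algebra.smul_def]; ring)

/-- The coefficient `(-1)ᵏ k! (d-k-1)!`. -/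
def coeff (K : Type*) [Field K] (d k : ℕ) : K :=
  (-1) ^ k * (Nat.factorial k : K) * (Nat.factorial (d - k - 1) : K)

/-- The coefficients of adjacent numbers of ones cancel in the invariance relation. -/
theorem coeff_succ_cancel {d k : ℕ} (h : k + 1 < d) :
    ((k + 1 : ℕ) : K) * coeff K d k + ((d - (k + 1) : ℕ) : K) * coeff K d (k + 1) = 0 := by
  obtain ⟨m, rfl⟩ := Nat.exists_eq_add_of_lt h
  have h1 : k + 1 + m + 1 - k - 1 = m + 1 := by omega
  have h2 : k + 1 + m + 1 - (k + 1) = m + 1 := by omega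
  simp only [coeff, h1, h2, Nat.add_sub_cancel, Nat.factorial_succ]
  push_cast
  ring

/-- The extension of the projection by zero on scalars. -/
def projExt (W : Submodule K (maximalIdeal R)) (e : (maximalIdeal R ⧸ W) ≃ₗ[K] K) : R →ₗ[K] K :=
  proj W e ∘ₗ nilPart ε hε

theorem projExt_one (W : Submodule K (maximalIdeal R)) (e : (maximalIdeal R ⧸ W) ≃ₗ[K] K) :
    projExt ε hε W e 1 = 0 := by
  have : nilPart ε hε 1 = 0 := Subtype.ext (by simp [nilPart])
  simp [projExt, this]

theorem projExt_of_mem (W : Submodule K (maximalIdeal R)) (e : (maximalIdeal R ⧸ W) ≃ₗ[K] K)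
    {x : R} (hx : x ∈ maximalIdeal R) : projExt ε hε W e x = proj W e ⟨x, hx⟩ := by
  have : nilPart ε hε x = ⟨x, hx⟩ := Subtype.ext (by simp [nilPart, (hε x).2 hx])
  simp [projExt, this]

theorem proj_eq_zero_iff (W : Submodule K (maximalIdeal R)) (e : (maximalIdeal R ⧸ W) ≃ₗ[K] K)
    {x : maximalIdeal R} : proj W e x = 0 ↔ x ∈ W := by
  simp [proj]

/-- As `projExt` kills `1`, a single formula covers `k = d` too, where the truncated `d - k - 1`
makes `coeff` a meaningless value. -/
theorem hasExplicitFormula_iff (W : Submodule K (maximalIdeal R))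
    (e : (maximalIdeal R ⧸ W) ≃ₗ[K] K) {d : ℕ} (F : MultilinearMap K (fun _ : Fin d => R) K) :
    HasExplicitFormula W e F ↔ ∀ b : Fin d → R, (∀ i, b i = 1 ∨ b i ∈ maximalIdeal R) →
      F b = coeff K d {i | b i = 1}.ncard * projExt ε hε W e (∏ i, b i) := by
  constructor
  · rintro ⟨h1, h2⟩ b hb
    by_cases hall : ∀ i, b i = 1
    · obtain rfl : b = fun _ => 1 := funext hall
      simp [h1, projExt_one]
    · push Not at hall
      obtain ⟨i, hi⟩ := hall
      have hp : ∏ i, b i ∈ maximalIdeal R :=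
        Ideal.mem_of_dvd _ (Finset.dvd_prod_of_mem b (Finset.mem_univ i)) ((hb i).resolve_left hi)
      rw [h2 b hb hp, projExt_of_mem ε hε W e hp, coeff]
  · intro H
    refine ⟨?_, fun b hb hp => ?_⟩
    · rw [H _ fun _ => Or.inl rfl]
      simp [projExt_one]
    · rw [H b hb, projExt_of_mem ε hε W e hp, coeff]

/-- The form `F_W`, expanded along `R = K ⊕ 𝔪` over the sets of positions at which the scalar
component is taken. -/
noncomputable def explicitForm (W : Submodule K (maximalIdeal R))
    (e : (maximalIdeal R ⧸ W) ≃ₗ[K] K) (d : ℕ) : MultilinearMap K (fun _ : Fin d => R) K :=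
  ∑ S : Finset (Fin d), coeff K d S.card •
    (projExt ε hε W e).compMultilinearMap
      ((MultilinearMap.mkPiAlgebra K (Fin d) R).compLinearMap fun i =>
        if i ∈ S then Algebra.linearMap K R ∘ₗ ε.toLinearMap
        else ((maximalIdeal R).subtype.restrictScalars K) ∘ₗ nilPart ε hε)

theorem hasExplicitFormula_explicitForm (W : Submodule K (maximalIdeal R))
    (e : (maximalIdeal R ⧸ W) ≃ₗ[K] K) (d : ℕ) :
    HasExplicitFormula W e (explicitForm ε hε W e d) := by
  classical
  rw [hasExplicitFormula_iff ε hε]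
  intro b hb
  let S₀ : Finset (Fin d) := Finset.univ.filter fun i => b i = 1
  have hcard : {i | b i = 1}.ncard = S₀.card := by
    rw [← Set.ncard_coe_finset]
    simp [S₀]
  have happ : ∀ (S : Finset (Fin d)) (i : Fin d),
      (if i ∈ S then Algebra.linearMap K R ∘ₗ ε.toLinearMap
        else ((maximalIdeal R).subtype.restrictScalars K) ∘ₗ nilPart ε hε) (b i) =
      if i ∈ S then algebraMap K R (ε (b i)) else b i - algebraMap K R (ε (b i)) := by
    intro S i
    split_ifs <;> simp [nilPart]
  simp only [explicitForm, sum_apply, smul_apply,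
    LinearMap.compMultilinearMap_apply, MultilinearMap.compLinearMap_apply,
    MultilinearMap.mkPiAlgebra_apply, happ]
  -- Only `S₀` survives: `ε` kills entries in `𝔪` and `nilPart` kills `1`, so a position where `S`
  -- and `S₀` differ gives a zero factor.
  rw [Finset.sum_eq_single S₀, hcard, smul_eq_mul]
  · congr 2
    refine Finset.prod_congr rfl fun i _ => ?_
    by_cases h1 : b i = 1
    · simp [S₀, h1]
    · simp [S₀, h1, (hε _).2 ((hb i).resolve_left h1)]
  · intro S _ hS
    obtain ⟨i, hi⟩ : ∃ i, ¬ (i ∈ S ↔ i ∈ S₀) := by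
      by_contra! hcon
      exact hS (Finset.ext hcon)
    rw [Finset.prod_eq_zero (Finset.mem_univ i), map_zero, smul_zero]
    by_cases h1 : b i = 1
    · have : i ∉ S := by simpa [S₀, h1] using hi
      simp [this, h1]
    · have : i ∈ S := by simpa [S₀, h1] using hi
      simp [this, (hε _).2 ((hb i).resolve_left h1)]
  · simp

end Construction

/-! ### Uniqueness, symmetry and invariance of `F_W` -/

section Properties

variable {K R : Type*} [Field K] [CommRing R] [IsLocalRing R] [Algebra K R]
variable (ε : R →ₐ[K] K) (hε : ∀ r, ε r = 0 ↔ r ∈ maximalIdeal R)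
variable {W : Submodule K (maximalIdeal R)} {e : (maximalIdeal R ⧸ W) ≃ₗ[K] K} {d : ℕ}
variable {F : MultilinearMap K (fun _ : Fin d => R) K}

include hε

theorem HasExplicitFormula.unique (hF : HasExplicitFormula W e F)
    {G : MultilinearMap K (fun _ : Fin d => R) K} (hG : HasExplicitFormula W e G) : G = F := by
  rw [hasExplicitFormula_iff ε hε] at hF hG
  exact multilinearMap_ext_of_one_or_mem ε hε fun b hb => (hG b hb).trans (hF b hb).symm

theorem HasExplicitFormula.symmetric (hF : HasExplicitFormula W e F) (σ : Equiv.Perm (Fin d))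
    (b : Fin d → R) : F (fun i => b (σ i)) = F b := by
  suffices h : F.domDomCongr σ = F from congrArg (fun G => G b) h
  refine HasExplicitFormula.unique ε hε hF ?_
  rw [hasExplicitFormula_iff ε hε] at hF ⊢
  intro b hb
  rw [MultilinearMap.domDomCongr_apply, hF _ fun i => hb (σ i), Equiv.prod_comp σ b]
  congr 2
  exact Set.ncard_preimage_of_injective_subset_range (s := {i | b i = 1}) σ.injective
    (by simp [σ.surjective.range_eq])

theorem HasExplicitFormula.exists_ne_zero [CharZero K] (hF : HasExplicitFormula W e F)
    (hd0 : d ≠ 0) (hd : ¬ ((maximalIdeal R ^ d : Ideal R) : Set R) ⊆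
      (fun x : maximalIdeal R => (x : R)) '' (W : Set (maximalIdeal R))) :
    ∃ z : Fin d → R, (∀ i, z i ∈ maximalIdeal R) ∧ F z ≠ 0 := by
  obtain ⟨n, rfl⟩ := Nat.exists_eq_succ_of_ne_zero hd0
  by_contra! hcon
  rw [hasExplicitFormula_iff ε hε] at hF
  refine hd fun x hx => ?_
  have hxm : x ∈ maximalIdeal R := Ideal.pow_le_self hd0 hx
  -- On `𝔪` the form is `(d-1)! π(z₁⋯z_d)`; were it zero, all these products, hence `𝔪^d`, would lie
  -- in `ker π = W`.
  have := pow_succ_subset_of_prod_mem (maximalIdeal R) n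
    (LinearMap.ker (projExt ε hε W e)).toAddSubgroup (fun z hz => ?_) x hx
  · refine ⟨⟨x, hxm⟩, (proj_eq_zero_iff W e).1 ?_, rfl⟩
    rw [← projExt_of_mem ε hε]
    simpa using this
  · have h0 := hcon z hz
    have hempty : {i | z i = 1} = ∅ :=
      Set.eq_empty_of_forall_notMem fun i hi => not_mem_of_eq_one hi (hz i)
    rw [hF z fun i => Or.inr (hz i), hempty] at h0
    simpa [coeff, Nat.factorial_ne_zero] using h0

theorem HasExplicitFormula.sum_update_mul (hF : HasExplicitFormula W e F)
    (hd : ((maximalIdeal R ^ (d + 1) : Ideal R) : Set R) ⊆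
      (fun x : maximalIdeal R => (x : R)) '' (W : Set (maximalIdeal R)))
    {a : maximalIdeal R} (ha : a ∈ W) (b : Fin d → R) :
    ∑ i, F (Function.update b i ((a : R) * b i)) = 0 := by
  classical
  rw [hasExplicitFormula_iff ε hε] at hF
  -- The invariance sum is itself multilinear in `b`, so it can be tested on entries `1` or in `𝔪`.
  let D : MultilinearMap K (fun _ : Fin d => R) K :=
    ∑ i, F.compLinearMap fun j => if j = i then LinearMap.mulLeft K (a : R) else LinearMap.id
  have hD : ∀ b, D b = ∑ i, F (Function.update b i ((a : R) * b i)) := by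
    intro b
    simp only [D, sum_apply, MultilinearMap.compLinearMap_apply]
    refine Finset.sum_congr rfl fun i _ => congrArg F (funext fun j => ?_)
    rcases eq_or_ne j i with rfl | hji
    · simp
    · simp [hji]
  rw [← hD]
  suffices h : D = 0 by simp [h]
  refine multilinearMap_ext_of_one_or_mem ε hε fun b hb => ?_
  rw [hD, zero_apply]
  set S : Set (Fin d) := {i | b i = 1} with hS
  have hmem : ∀ i, (a : R) * b i ∈ maximalIdeal R := fun i => Ideal.mul_mem_right _ _ a.2
  -- Multiplying by `a ∈ 𝔪` turns a `1` into a non-`1` and leaves the other positions' status alone,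
  -- so the count of ones drops exactly when `i ∈ S`.
  have hterm : ∀ i, F (Function.update b i ((a : R) * b i)) =
      (if i ∈ S then coeff K d (S.ncard - 1) else coeff K d S.ncard) *
        projExt ε hε W e (a * ∏ i, b i) := by
    intro i
    rw [hF]
    · have hset : {j | Function.update b i ((a : R) * b i) j = 1} = S \ {i} := by
        ext j
        rcases eq_or_ne j i with rfl | hji
        · simpa using fun h => not_mem_of_eq_one h (hmem j)
        · simp [hji, S]
      have hprod : ∏ j, Function.update b i ((a : R) * b i) j = a * ∏ i, b i := by
        rw [Finset.prod_update_of_mem (Finset.mem_univ i), mul_assoc,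
          ← Finset.prod_eq_mul_prod_sdiff_singleton_of_mem (Finset.mem_univ i)]
      rw [hset, hprod]
      split_ifs with hi
      · rw [Set.ncard_sdiff_singleton_of_mem hi]
      · rw [Set.sdiff_singleton_eq_self hi]
    · intro j
      rcases eq_or_ne j i with rfl | hji
      · simpa using Or.inr (hmem j)
      · simpa [hji] using hb j
  simp only [hterm]
  rw [← Finset.sum_mul, Finset.sum_ite, Finset.sum_const, Finset.sum_const]
  have hc1 : (Finset.univ.filter fun i => i ∈ S).card = S.ncard := by
    rw [← Set.ncard_coe_finset]; simp
  have hc2 : (Finset.univ.filter fun i => i ∉ S).card = d - S.ncard := by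
    have := Finset.card_filter_add_card_filter_not (s := (Finset.univ : Finset (Fin d)))
      (fun i => i ∈ S)
    rw [hc1, Finset.card_univ, Fintype.card_fin] at this
    omega
  rw [hc1, hc2, nsmul_eq_mul, nsmul_eq_mul]
  have hle : S.ncard ≤ d := by
    simpa using Set.ncard_le_card S
  rcases Nat.eq_zero_or_pos S.ncard with h0 | hpos
  · have hemp : S = ∅ := (Set.ncard_eq_zero).1 h0
    have hbm : ∀ i, b i ∈ maximalIdeal R := fun i =>
      (hb i).resolve_left fun h => by
        have : i ∈ S := h
        simp [hemp] at this
    have hp : (a : R) * ∏ i, b i ∈ maximalIdeal R ^ (d + 1) := by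
      rw [pow_succ']
      refine Ideal.mul_mem_mul a.2 ?_
      simpa using Ideal.prod_mem_prod (s := Finset.univ) (I := fun _ : Fin d => maximalIdeal R)
        fun i _ => hbm i
    obtain ⟨w, hw, hwe⟩ := hd hp
    have : projExt ε hε W e (a * ∏ i, b i) = 0 := by
      rw [← hwe, projExt_of_mem ε hε W e w.2]
      exact (proj_eq_zero_iff W e).2 hw
    rw [this, mul_zero]
  · rcases hle.lt_or_eq with hlt | heq
    · obtain ⟨k, hk⟩ := Nat.exists_eq_succ_of_ne_zero hpos.ne'
      rw [hk] at hlt ⊢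
      rw [Nat.succ_sub_one, Nat.succ_eq_add_one, coeff_succ_cancel hlt, zero_mul]
    · have hall : S = Set.univ := by
        rw [Set.eq_univ_iff_ncard]; simpa using heq
      have hb1 : ∀ i, b i = 1 := fun i => by
        have : i ∈ S := hall ▸ Set.mem_univ i
        exact this
      have : projExt ε hε W e (a * ∏ i, b i) = 0 := by
        rw [Finset.prod_eq_one fun i _ => hb1 i, mul_one, projExt_of_mem ε hε W e a.2]
        exact (proj_eq_zero_iff W e).2 ha
      rw [this, mul_zero]

theorem HasExplicitFormula.isInvariantWrt [CharZero K] (hF : HasExplicitFormula W e F)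
    (hd0 : d ≠ 0)
    (hd : IsGreatest {j : ℕ | ¬ ((maximalIdeal R ^ j : Ideal R) : Set R) ⊆
      (fun x : maximalIdeal R => (x : R)) '' (W : Set (maximalIdeal R))} d) :
    IsInvariantWrt W F where
  symmetric := hF.symmetric ε hε
  map_one := hF.1
  ne_zero := hF.exists_ne_zero ε hε hd0 hd.1
  star a ha b := by
    refine hF.sum_update_mul ε hε ?_ ha b
    by_contra hcon
    exact absurd (hd.2 hcon) (by simp)

/-- The linear part of `F_W` at `1` is a nonzero multiple of the projection. -/
theorem HasExplicitFormula.apply_update_one_ne_zero [CharZero K] (hF : HasExplicitFormula W e F)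
    (i : Fin d) {z : maximalIdeal R} (hz : z ∉ W) :
    F (Function.update (fun _ => 1) i (z : R)) ≠ 0 := by
  classical
  rw [hasExplicitFormula_iff ε hε] at hF
  rw [hF]
  · rw [Finset.prod_update_of_mem (Finset.mem_univ i)]
    simp only [Finset.prod_const_one, mul_one]
    rw [projExt_of_mem ε hε W e z.2]
    refine mul_ne_zero ?_ (mt (proj_eq_zero_iff W e).1 hz)
    simp [coeff, Nat.factorial_ne_zero]
  · intro j
    rcases eq_or_ne j i with rfl | hji
    · simp
    · simp [hji]

end Properties

/-! ### Irreducibility -/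

section Product

variable {K R : Type*} [Field K] [CommRing R] [Algebra K R]

/-- The product of two forms vanishing at `1` vanishes to second order at `1`. -/
theorem symProd_update_one_eq_zero {d₁ d₂ : ℕ} {F₁ : MultilinearMap K (fun _ : Fin d₁ => R) K}
    {F₂ : MultilinearMap K (fun _ : Fin d₂ => R) K} (h₁ : F₁ (fun _ => 1) = 0)
    (h₂ : F₂ (fun _ => 1) = 0) (i : Fin (d₁ + d₂)) (z : R) :
    symProd F₁ F₂ (Function.update (fun _ => 1) i z) = 0 := by
  rw [symProd, Finset.sum_eq_zero, mul_zero]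
  intro σ _
  -- The single entry `z` lands in the arguments of one factor; the other factor is evaluated at
  -- `(1,…,1)`.
  obtain ⟨k, rfl⟩ := σ.surjective i
  induction k using Fin.addCases with
  | left k =>
    rw [show (fun j => Function.update (fun _ => (1 : R)) (σ (Fin.castAdd d₂ k)) z
      (σ (Fin.natAdd d₁ j))) = fun _ => 1 from funext fun j => ?_, h₂, mul_zero]
    refine Function.update_of_ne (fun h => ?_) _ _
    have := congrArg Fin.val (σ.injective h)
    simp at this
    omega
  | right k =>
    rw [show (fun j => Function.update (fun _ => (1 : R)) (σ (Fin.natAdd d₁ k)) z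
      (σ (Fin.castAdd d₂ j))) = fun _ => 1 from funext fun j => ?_, h₁, zero_mul]
    refine Function.update_of_ne (fun h => ?_) _ _
    have := congrArg Fin.val (σ.injective h)
    simp at this
    omega

end Product

end LocalAlgForm

theorem lemma3 {K R : Type*} [Field K] [IsAlgClosed K] [CharZero K]
    [CommRing R] [IsLocalRing R] [Algebra K R] [FiniteDimensional K R]
    (W : Submodule K (IsLocalRing.maximalIdeal R)) (hW : LocalAlgForm.IsGeneratingHyperplane W)
    (d : ℕ)
    (hd : IsGreatest {j : ℕ | ¬ ((IsLocalRing.maximalIdeal R ^ j : Ideal R) : Set R) ⊆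
      (fun x : IsLocalRing.maximalIdeal R => (x : R)) '' (W : Set (IsLocalRing.maximalIdeal R))} d)
    (e : (IsLocalRing.maximalIdeal R ⧸ W) ≃ₗ[K] K) :
    ∃ F : MultilinearMap K (fun _ : Fin d => R) K,
      LocalAlgForm.HasExplicitFormula W e F ∧
      (∀ G : MultilinearMap K (fun _ : Fin d => R) K,
        LocalAlgForm.HasExplicitFormula W e G → G = F) ∧
      LocalAlgForm.IsInvariantWrt W F ∧
      LocalAlgForm.IsIrreducibleInvariant F := by
  obtain ⟨ε, hε⟩ := LocalAlgForm.exists_algHom_ker_eq_maximalIdeal (K := K) (R := R)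
  obtain ⟨z, hz⟩ : ∃ z, z ∉ W := by
    by_contra! hall
    obtain rfl : W = ⊤ := Submodule.eq_top_iff'.2 hall
    have := hW.codim_one
    rw [Module.finrank_zero_of_subsingleton] at this
    exact zero_ne_one this
  have hd0 : d ≠ 0 := by
    -- The exponent `1` is admissible, since `z ∈ 𝔪` lies outside `W`.
    have : 1 ≤ d := hd.2 fun hsub => by
      obtain ⟨w, hw, hwz⟩ := hsub (by simp : (z : R) ∈ _)
      exact hz (Subtype.ext hwz ▸ hw)
    omega
  have hF := LocalAlgForm.hasExplicitFormula_explicitForm ε hε W e d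
  have hinv := hF.isInvariantWrt ε hε hd0 hd
  refine ⟨LocalAlgForm.explicitForm ε hε W e d, hF, fun G hG => hF.unique ε hε hG, hinv, ⟨W, hW, hinv⟩, ?_⟩
  rintro ⟨_, _, d₁, d₂, rfl, F₁, F₂, h₁, h₂, hprod⟩
  have i : Fin (d₁ + d₂) := ⟨0, Nat.pos_of_ne_zero hd0⟩
  refine hF.apply_update_one_ne_zero ε hε i hz ?_
  rw [hprod]
  exact LocalAlgForm.symProd_update_one_eq_zero h₁.map_one h₂.map_one i z
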